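/- Let $n,w$ be integers with $w\ge 2$ and $n\ge 2w$. The Johnson graph $J(n,w)$ has the $w$-subsets of $\{1,\dots,n\}$ as vertices, two of them being adjacent when they meet in exactly $w-1$ elements. Let $V_1$ be the eigenspace of its (real) adjacency matrix for the eigenvalue $\lambda_1=(w-1)(n-w-1)-1$; a $\lambda_1$-eigenvector is a nonzero $v\in V_1$. The support size of $v$ is its number of nonzero entries, and $m_1^0(n,w)$ is the minimum support size of a $\lambda_1$-eigenvector. For $a=(\alpha_1,\dots,\alpha_n)\in\mathbb{R}^n$ let $I(a)$ be the vector, indexed by the $w$-subsets $x$, with entries $I(a)_x=\sum_{i\in x}\alpha_i$, and let $e_1,\dots,e_n$ be the standard basis of $\mathbb{R}^n$. **Theorem.** (1) If $(n,w)\ne(5,2)$, then every $\lambda_1$-eigenvector of $J(n,w)$ with minimum support is, up to a permutation of the coordinates $1,\dots,n$ and multiplication by a nonzero scalar, either $I(e_1-e_2)$ or $I\bigl(\sum_{i=1}^{k}e_i-\frac{k}{n-k}\sum_{i=k+1}^{n}e_i\bigr)$ for some $k\in\{2,3,\dots,n-2\}$ such that $\frac{kw}{n}$ is an integer. (2) In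 all cases (including $(n,w)=(5,2)$), $$m_1^0(n,w)=\min\left(2\binom{n-2}{w-1},\ \binom nw-\max_{k}\binom{k}{kw/n}\binom{n-k}{(n-k)w/n}\right),$$ where the maximum is over the $k\in\{2,3,\dots,n-2\}$ for which $\frac{kw}{n}$ is an integer, and is taken to be $0$ if there is no such $k$ (in which case $m_1^0(n,w)=2\binom{n-2}{w-1}$). -/

import Mathlib

namespace Johnson

/-- The `w`-subsets of an `n`-element set. -/
abbrev Vertex (n w : ℕ) : Type := {x : Finset (Fin n) // x.card = w}

/-- The Johnson graph `J(n,w)`: two `w`-subsets are adjacent when they meet in `w - 1` elements. -/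
def graph (n w : ℕ) : SimpleGraph (Vertex n w) where
  Adj x y := (x.1 ∩ y.1).card + 1 = w
  symm := ⟨fun x y h => by rw [Finset.inter_comm]; exact h⟩
  loopless := ⟨fun x h => by
    rw [Finset.inter_self, x.2] at h
    omega⟩

instance (n w : ℕ) : DecidableRel (graph n w).Adj :=
  fun x y => inferInstanceAs (Decidable ((x.1 ∩ y.1).card + 1 = w))

/-- The eigenvalue `λ_i(n,w) = (w - i)(n - w - i) - i` of `J(n,w)`. -/
def eigenvalue (n w i : ℕ) : ℝ :=
  ((w : ℝ) - i) * ((n : ℝ) - w - i) - i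

/-- The eigenspace `V_i` of the adjacency matrix of `J(n,w)` for the eigenvalue `λ_i(n,w)`. -/
noncomputable def eigenspace (n w i : ℕ) : Submodule ℝ (Vertex n w → ℝ) :=
  Module.End.eigenspace (Matrix.toLin' ((graph n w).adjMatrix ℝ)) (eigenvalue n w i)

/-- The size `|X₊(v)| + |X₋(v)|` of the support of `v`. -/
noncomputable def supportSize {n w : ℕ} (v : Vertex n w → ℝ) : ℕ :=
  (Finset.univ.filter fun x => 0 < v x).card + (Finset.univ.filter fun x => v x < 0).card

/-- The support sizes of the nonzero vectors of `V_i`; their minimum is `m_i^0(n,w)`. -/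
def supportSizes (n w i : ℕ) : Set ℕ :=
  {m | ∃ v ∈ eigenspace n w i, v ≠ 0 ∧ supportSize v = m}

/-- `v` is a `λ_i`-eigenvector (hence nonzero) of `J(n,w)` with minimum support. -/
def IsMinSupportEigenvector {n w : ℕ} (i : ℕ) (v : Vertex n w → ℝ) : Prop :=
  v ∈ eigenspace n w i ∧ v ≠ 0 ∧
    ∀ u ∈ eigenspace n w i, u ≠ 0 → supportSize v ≤ supportSize u

/-- The inclusion mapping `I`, given by `I(a)_x = ∑_{i ∈ x} a_i`. -/
noncomputable def inclusion (n w : ℕ) (a : Fin n → ℝ) : Vertex n w → ℝ :=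
  fun x => ∑ i ∈ x.1, a i

/-- The image of a `w`-subset under a permutation of the coordinates. -/
def permute {n w : ℕ} (σ : Equiv.Perm (Fin n)) (x : Vertex n w) : Vertex n w :=
  ⟨x.1.map σ.toEmbedding, by rw [Finset.card_map]; exact x.2⟩

/-- `v` equals `u` up to a permutation of the coordinates and a nonzero scalar. -/
def Equivalent {n w : ℕ} (v u : Vertex n w → ℝ) : Prop :=
  ∃ (σ : Equiv.Perm (Fin n)) (c : ℝ), c ≠ 0 ∧ ∀ x, v x = c * u (permute σ x)

/-- The vector `e_1 - e_2`; the coordinates are numbered from `0`. -/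
noncomputable def basisDiff (n : ℕ) : Fin n → ℝ :=
  fun i => if i.val = 0 then 1 else if i.val = 1 then -1 else 0

/-- The vector `∑_{i ≤ k} e_i - k / (n - k) ∑_{i > k} e_i`; the coordinates are numbered
from `0`. -/
noncomputable def twoValued (n k : ℕ) : Fin n → ℝ :=
  fun i => if i.val < k then 1 else -((k : ℝ) / ((n : ℝ) - k))

/-- The integers `2 ≤ k ≤ n - 2` such that `k w / n` is an integer. -/
def admissible (n w : ℕ) : Finset ℕ :=
  (Finset.Icc 2 (n - 2)).filter fun k => n ∣ k * w

/-- The largest product `(k choose kw/n) (n-k choose (n-k)w/n)` over the admissible `k`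
(both divisions are exact); it is `0` if there is no admissible `k`. -/
def maxZeros (n w : ℕ) : ℕ :=
  (admissible n w).sup fun k => k.choose (k * w / n) * (n - k).choose ((n - k) * w / n)

end Johnson

/-! Let `B` send a function on `w`-sets to its sums over the sets covering a `(w-1)`-set. Then `BᵀB`
is the adjacency matrix plus `w`, and `BBᵀ - BᵀB` is scalar on each level. So `B` carries a solution
of the `λ_1` equation to a solution one level down. At singletons the equation says only that the
values sum to zero, and climbing back shows that `V_1` consists of the `I(a)` with `∑ a i = 0`
(`mem_eigenspace_one_iff`). It remains to count the `w`-sets on which such an `a` has nonzero sum.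

If `a` takes distinct values at `i, j, k`, split the `w`-sets by their trace on `{i, j, k}`. For a
fixed remainder outside the triple, the three traces of size one give three distinct sums, and so do
the three of size two; at most one sum in each group vanishes. This yields `2 C(n-3, w-1) + 2 C(n-3,
w-2) = 2 C(n-2, w-1)` nonzero sums (`nonzeroCount_three_values`), and for `n ≥ w + 4` sharpness
forces a multiple of some `e_p - e_q` (`support_pair_of_three_values`).

If `a` has exactly two values, one of them on a set `s` of size `k`, the sum over `x` vanishes
exactly when `|x ∩ s| = kw/n`, which gives the product of binomials. If `kw/n` is not an integer,
the support is full and exceeds the bound. -/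

namespace Johnson

open Finset

/-! ### The eigenspace `V_1` and zero-sum vectors -/

/-- Sum of `f` over the sets covering `y`. -/
def upperSum {n : ℕ} (f : Finset (Fin n) → ℝ) (y : Finset (Fin n)) : ℝ :=
  ∑ j ∈ yᶜ, f (insert j y)

lemma upperSum_erase {n : ℕ} (f : Finset (Fin n) → ℝ) {x : Finset (Fin n)} {i : Fin n}
    (hi : i ∈ x) :
    upperSum f (x.erase i) = f x + ∑ j ∈ xᶜ, f (insert j (x.erase i)) := by
  have h : (x.erase i)ᶜ = insert i xᶜ := by
    ext j; by_cases hj : j = i <;> simp [hj]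
  rw [upperSum, h, sum_insert (by simpa using hi), insert_erase hi]

/-- If `f` satisfies the eigenvalue equation `BᵀB f = μ f` on `(m+1)`-sets, where `B` is
`upperSum`, then `B f` satisfies it on `m`-sets with a shifted eigenvalue. -/
lemma upperSum_eigen {n m : ℕ} {μ : ℝ} {f : Finset (Fin n) → ℝ}
    (hf : ∀ x : Finset (Fin n), x.card = m + 1 → ∑ i ∈ x, upperSum f (x.erase i) = μ * f x)
    (y : Finset (Fin n)) (hy : y.card = m) :
    ∑ i ∈ y, upperSum (upperSum f) (y.erase i) = (μ - (n - 2 * m)) * upperSum f y := by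
  have h1 : μ * upperSum f y = ∑ j ∈ yᶜ, (upperSum f y +
      ∑ i ∈ y, upperSum f (insert j (y.erase i))) := by
    rw [upperSum, mul_sum]
    refine sum_congr rfl fun j hj => ?_
    have hj' : j ∉ y := by simpa using hj
    rw [← hf _ (by rw [card_insert_of_notMem hj', hy]), sum_insert hj', erase_insert hj']
    congr 1
    refine sum_congr rfl fun i hi => ?_
    rw [erase_insert_of_ne (by rintro rfl; exact hj' hi)]
  have h2 : ∑ i ∈ y, upperSum (upperSum f) (y.erase i) =
      m * upperSum f y + ∑ i ∈ y, ∑ j ∈ yᶜ, upperSum f (insert j (y.erase i)) := by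
    rw [sum_congr rfl fun i hi => upperSum_erase (upperSum f) hi, sum_add_distrib]
    simp [hy]
  have h3 : ((yᶜ.card : ℕ) : ℝ) = n - m := by
    rw [card_compl, Fintype.card_fin, hy, Nat.cast_sub]
    simpa [hy] using card_le_univ y
  rw [sum_add_distrib, sum_const, nsmul_eq_mul, h3, sum_comm] at h1
  rw [h2]
  linarith

lemma sum_sum_erase {n m : ℕ} (a : Fin n → ℝ) {x : Finset (Fin n)} (hx : x.card = m + 1) :
    ∑ i ∈ x, ∑ k ∈ x.erase i, a k = m * ∑ k ∈ x, a k := by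
  rw [sum_congr rfl fun i hi => sum_erase_eq_sub (a := i) hi]
  rw [sum_sub_distrib, sum_const, nsmul_eq_mul, hx]
  push_cast; ring

/-- Solutions of the eigenvalue equation on `(m+1)`-sets are the sums of a zero-sum vector. -/
lemma exists_sum_of_eigen {n : ℕ} (m : ℕ) (hm : m + 1 < n) (f : Finset (Fin n) → ℝ)
    (hf : ∀ x : Finset (Fin n), x.card = m + 1 →
      ∑ i ∈ x, upperSum f (x.erase i) = (m * (n - m - 1) : ℝ) * f x) :
    ∃ a : Fin n → ℝ, ∑ i, a i = 0 ∧
      ∀ x : Finset (Fin n), x.card = m + 1 → f x = ∑ i ∈ x, a i := by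
  induction m generalizing f with
  | zero =>
    refine ⟨fun i => f {i}, ?_, fun x hx => ?_⟩
    · have := hf {⟨0, by omega⟩} (by simp)
      simpa [upperSum] using this
    · obtain ⟨i, rfl⟩ := card_eq_one.mp hx
      simp
  | succ m ih =>
    -- The shift turns `(m+1)(n-m-2)` into `(m+1)(n-m-2) - (n-2(m+1)) = m(n-m-1)`, the same form one
    -- level down.
    obtain ⟨b, hb, hfb⟩ := ih (by omega) (upperSum f) fun y hy => by
      rw [upperSum_eigen hf y hy]; push_cast; ring
    have hn : (m + 1 + 1 : ℝ) < n := by exact_mod_cast hm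
    -- A nonzero eigenvalue lets `f` be recovered from `B f` by applying `Bᵀ` and dividing.
    have hμ : ((m + 1 : ℝ) * (n - (m + 1) - 1)) ≠ 0 :=
      mul_ne_zero (by positivity) (by linarith)
    refine ⟨fun i => (n - (m + 1) - 1 : ℝ)⁻¹ * b i, by rw [← mul_sum, hb, mul_zero],
      fun x hx => ?_⟩
    have h := hf x hx
    rw [sum_congr rfl fun i hi => hfb (x.erase i) (by rw [card_erase_of_mem hi, hx]; rfl),
      sum_sum_erase b hx] at h
    push_cast at h
    rw [← mul_sum]
    have h1 := (mul_ne_zero_iff.mp hμ).1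
    have h2 := (mul_ne_zero_iff.mp hμ).2
    rw [mul_assoc] at h
    rw [mul_left_cancel₀ h1 h, inv_mul_cancel_left₀ h2]

/-- The sum over `y` occurs `n - |y|` times, and the added elements contribute the sum over `yᶜ`,
which is minus the sum over `y`. -/
lemma upperSum_sum {n : ℕ} {a : Fin n → ℝ} (ha : ∑ i, a i = 0) (y : Finset (Fin n)) :
    upperSum (fun x => ∑ i ∈ x, a i) y = (n - y.card - 1) * ∑ i ∈ y, a i := by
  have h : ∀ j ∈ yᶜ, ∑ i ∈ insert j y, a i = a j + ∑ i ∈ y, a i := fun j hj =>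
    sum_insert (by simpa using hj)
  have h3 : ((yᶜ.card : ℕ) : ℝ) = n - y.card := by
    rw [card_compl, Fintype.card_fin, Nat.cast_sub]
    simpa using card_le_univ y
  have h4 := sum_add_sum_compl y a
  rw [upperSum, sum_congr rfl h, sum_add_distrib, sum_const, nsmul_eq_mul, h3]
  linarith

/-- Extension of a function on the `w`-sets by zero. -/
noncomputable def extend {n w : ℕ} (v : Vertex n w → ℝ) (x : Finset (Fin n)) : ℝ :=
  if h : x.card = w then v ⟨x, h⟩ else 0

lemma extend_coe {n w : ℕ} (v : Vertex n w → ℝ) (x : Vertex n w) : extend v x.1 = v x := by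
  simp [extend, x.2]

/-- Each neighbour arises from exactly one exchange of some `i ∈ x` for some `j ∉ x`. -/
lemma sum_adj {n w : ℕ} (f : Finset (Fin n) → ℝ) (x : Vertex n w) :
    ∑ y ∈ univ.filter ((graph n w).Adj x), f y.1 =
      ∑ i ∈ x.1, ∑ j ∈ x.1ᶜ, f (insert j (x.1.erase i)) := by
  rw [← sum_product']
  symm
  have hmem : ∀ p ∈ x.1 ×ˢ x.1ᶜ, p.1 ∈ x.1 ∧ p.2 ∉ x.1 := by simp
  have hpos : ∀ p ∈ x.1 ×ˢ x.1ᶜ, x.1.card ≠ 0 := fun p hp =>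
    card_ne_zero_of_mem (hmem p hp).1
  refine sum_bij (fun p hp => ⟨insert p.2 (x.1.erase p.1), ?_⟩) ?_ ?_ ?_ ?_
  · have h := hmem p hp
    rw [card_insert_of_notMem (by simp [h.2]), card_erase_of_mem h.1]
    have := hpos p hp
    have := x.2
    omega
  · intro p hp
    have h := hmem p hp
    rw [mem_filter]
    refine ⟨mem_univ _, ?_⟩
    change (x.1 ∩ insert p.2 (x.1.erase p.1)).card + 1 = w
    rw [inter_insert_of_notMem h.2, inter_eq_right.mpr (erase_subset _ _),
      card_erase_of_mem h.1]
    have := hpos p hp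
    have := x.2
    omega
  · rintro ⟨i, j⟩ hp ⟨i', j'⟩ hq heq
    obtain ⟨h1, h2⟩ := hmem _ hp
    obtain ⟨h3, h4⟩ := hmem _ hq
    simp only [Subtype.mk.injEq] at heq h1 h2 h3 h4
    have e1 := Finset.ext_iff.mp heq j
    have e2 := Finset.ext_iff.mp heq i'
    simp only [mem_insert, mem_erase] at e1 e2
    ext1 <;> grind
  · rintro ⟨y, hy⟩ hxy
    replace hxy : (x.1 ∩ y).card + 1 = w := (mem_filter.mp hxy).2
    have hx := x.2
    have c1 := card_sdiff_add_card_inter x.1 y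
    have c2 := card_sdiff_add_card_inter y x.1
    rw [inter_comm y] at c2
    obtain ⟨i, hi⟩ := card_eq_one.mp (show (x.1 \ y).card = 1 by omega)
    obtain ⟨j, hj⟩ := card_eq_one.mp (show (y \ x.1).card = 1 by omega)
    have hi' := Finset.ext_iff.mp hi
    have hj' := Finset.ext_iff.mp hj
    simp only [mem_sdiff, mem_singleton] at hi' hj'
    refine ⟨(i, j), ?_, ?_⟩
    · have := hi' i; have := hj' j; simp; grind
    · ext k
      have := hi' k; have := hj' k; simp only [mem_insert, mem_erase]; grind
  · intro p hp; rfl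

lemma mem_eigenspace_iff {n w i : ℕ} (v : Vertex n w → ℝ) :
    v ∈ eigenspace n w i ↔ ∀ x : Vertex n w,
      ∑ i ∈ x.1, upperSum (extend v) (x.1.erase i) = (eigenvalue n w i + w) * v x := by
  rw [eigenspace, Module.End.mem_eigenspace_iff, funext_iff]
  refine forall_congr' fun x => ?_
  rw [Matrix.toLin'_apply, SimpleGraph.adjMatrix_mulVec_apply,
    SimpleGraph.neighborFinset_eq_filter,
    sum_congr rfl fun y _ => (extend_coe v y).symm, sum_adj,
    sum_congr rfl fun i hi => upperSum_erase (extend v) hi, sum_add_distrib, sum_const, x.2,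
    extend_coe, Pi.smul_apply, nsmul_eq_mul, smul_eq_mul, add_mul, add_comm (_ * v x) (_ * v x)]
  constructor <;> intro h <;> linarith

/-- The eigenspace `V_1` is the image under `I` of the zero-sum vectors. -/
theorem mem_eigenspace_one_iff {n w : ℕ} (hw : 1 ≤ w) (hn : w < n) (v : Vertex n w → ℝ) :
    v ∈ eigenspace n w 1 ↔ ∃ a : Fin n → ℝ, ∑ i, a i = 0 ∧ v = inclusion n w a := by
  obtain ⟨m, rfl⟩ := Nat.exists_eq_add_of_le' hw
  have hμ : eigenvalue n (m + 1) 1 + (m + 1 : ℕ) = m * (n - m - 1) := by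
    rw [eigenvalue]; push_cast; ring
  rw [mem_eigenspace_iff, hμ]
  constructor
  · intro h
    obtain ⟨a, ha, hfa⟩ := exists_sum_of_eigen m hn (extend v) fun x hx => by
      rw [h ⟨x, hx⟩, ← extend_coe v ⟨x, hx⟩]
    exact ⟨a, ha, funext fun x => by rw [← extend_coe v, hfa _ x.2]; rfl⟩
  · rintro ⟨a, ha, rfl⟩ x
    have h : ∀ i ∈ x.1, upperSum (extend (inclusion n (m + 1) a)) (x.1.erase i) =
        (n - m - 1) * ∑ k ∈ x.1.erase i, a k := fun i hi => by
      have hc : (x.1.erase i).card = m := by rw [card_erase_of_mem hi, x.2]; rfl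
      have e := upperSum_sum ha (x.1.erase i)
      rw [hc] at e
      rw [← e, upperSum, upperSum]
      refine sum_congr rfl fun j hj => ?_
      -- Only `w`-sets are evaluated, so the default value 0 plays no role.
      rw [extend, dif_pos (by rw [card_insert_of_notMem (mem_compl.mp hj), hc])]
      rfl
    rw [sum_congr rfl h, ← mul_sum, sum_sum_erase a x.2, inclusion]
    ring

/-! ### Support size as a count of nonzero `w`-sums -/

/-- The number of `w`-sets on which `a` has nonzero sum. -/
noncomputable def nonzeroCount {n : ℕ} (w : ℕ) (a : Fin n → ℝ) : ℕ :=
  ((powersetCard w univ).filter fun x => ∑ i ∈ x, a i ≠ 0).card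

lemma supportSize_inclusion {n w : ℕ} (a : Fin n → ℝ) :
    supportSize (inclusion n w a) = nonzeroCount w a := by
  rw [supportSize, ← card_union_of_disjoint]
  · refine card_bij (fun x _ => x.1) ?_ ?_ ?_
    · intro x hx
      refine mem_filter.mpr ⟨mem_powersetCard.mpr ⟨subset_univ _, x.2⟩, ?_⟩
      rcases mem_union.mp hx with hx | hx
      · exact ne_of_gt (mem_filter.mp hx).2
      · exact ne_of_lt (mem_filter.mp hx).2
    · intro x _ y _ h
      exact Subtype.ext h
    · intro x hx
      simp only [mem_filter, mem_powersetCard, subset_univ, true_and] at hx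
      refine ⟨⟨x, hx.1⟩, mem_union.mpr ?_, rfl⟩
      exact hx.2.symm.lt_or_gt.imp (fun h => mem_filter.mpr ⟨mem_univ _, h⟩)
        fun h => mem_filter.mpr ⟨mem_univ _, h⟩
  · rw [disjoint_filter]
    intro x _ h1 h2
    exact lt_asymm h1 h2

lemma sum_powersetCard_insert {α M : Type*} [DecidableEq α] [AddCommMonoid M] {s : Finset α}
    {i : α} (hi : i ∉ s) (m : ℕ) (g : Finset α → M) :
    ∑ x ∈ powersetCard (m + 1) (insert i s), g x =
      ∑ x ∈ powersetCard (m + 1) s, g x + ∑ y ∈ powersetCard m s, g (insert i y) := by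
  rw [powersetCard_succ_insert hi, sum_union, sum_image]
  · intro x hx y hy h
    have hx' : i ∉ x := fun h => hi ((mem_powersetCard.mp hx).1 h)
    have hy' : i ∉ y := fun h => hi ((mem_powersetCard.mp hy).1 h)
    rw [← erase_insert hx', ← erase_insert hy', h]
  · rw [disjoint_left]
    intro x hx hx'
    obtain ⟨y, -, rfl⟩ := mem_image.mp hx'
    exact hi ((mem_powersetCard.mp hx).1 (mem_insert_self _ _))

lemma sum_powersetCard_insert_insert {α M : Type*} [DecidableEq α] [AddCommMonoid M]
    {s : Finset α} {i j : α} (hij : i ≠ j) (hi : i ∉ s) (hj : j ∉ s) (m : ℕ)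
    (g : Finset α → M) :
    ∑ x ∈ powersetCard (m + 2) (insert i (insert j s)), g x =
      ∑ x ∈ powersetCard (m + 2) s, g x
        + ∑ y ∈ powersetCard (m + 1) s, (g (insert i y) + g (insert j y))
        + ∑ y ∈ powersetCard m s, g (insert i (insert j y)) := by
  have hi' : i ∉ insert j s := by simp [hij, hi]
  rw [sum_powersetCard_insert hi', sum_powersetCard_insert hj, sum_powersetCard_insert hj,
    sum_add_distrib]
  abel

lemma exists_mem_powersetCard_notMem {α : Type*} [DecidableEq α] {s t : Finset α} {m : ℕ}
    (h : m + t.card ≤ s.card) : ∃ y ∈ powersetCard m s, ∀ i ∈ t, i ∉ y := by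
  obtain ⟨y, hy, hc⟩ := exists_subset_card_eq (s := s \ t) (n := m)
    (by have := le_card_sdiff t s; omega)
  exact ⟨y, mem_powersetCard.mpr ⟨hy.trans sdiff_subset, hc⟩,
    fun i hi hiy => (mem_sdiff.mp (hy hiy)).2 hi⟩

/-- For a `(w-1)`-set `y` avoiding `i` and `j`, the entries at `y ∪ {i}` and `y ∪ {j}` differ by `a
i - a j`. -/
lemma inclusion_ne_zero {n w : ℕ} (hw : 1 ≤ w) (hn : w < n) {a : Fin n → ℝ} {i j : Fin n}
    (h : a i ≠ a j) : inclusion n w a ≠ 0 := by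
  intro h0
  have hij : i ≠ j := fun e => h (by rw [e])
  obtain ⟨y, hy, hy'⟩ := exists_mem_powersetCard_notMem (s := univ) (t := {i, j}) (m := w - 1)
    (by rw [card_pair hij, card_univ, Fintype.card_fin]; omega)
  have hc := (mem_powersetCard.mp hy).2
  have key : ∀ k ∈ ({i, j} : Finset (Fin n)), a k + ∑ l ∈ y, a l = 0 := fun k hk => by
    rw [← sum_insert (hy' k hk)]
    exact congrFun h0 ⟨insert k y, by rw [card_insert_of_notMem (hy' k hk)]; omega⟩
  have := key i (by simp)
  have := key j (by simp)
  exact h (by linarith)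

/-- Indicator of a nonzero sum. -/
noncomputable def nz {n : ℕ} (a : Fin n → ℝ) (x : Finset (Fin n)) : ℕ :=
  if ∑ i ∈ x, a i ≠ 0 then 1 else 0

lemma nonzeroCount_eq_sum {n w : ℕ} (a : Fin n → ℝ) :
    nonzeroCount w a = ∑ x ∈ powersetCard w univ, nz a x := card_filter _ _

lemma univ_eq_pair {n : ℕ} {i j : Fin n} :
    (univ : Finset (Fin n)) = insert i (insert j ({i, j}ᶜ)) := by
  ext l; simp; tauto

lemma nonzeroCount_of_support_pair {n m : ℕ} {a : Fin n → ℝ} {i j : Fin n}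
    (hij : i ≠ j) (hi : a i ≠ 0) (hj : a j = -a i) (ha : ∀ l, l ≠ i → l ≠ j → a l = 0) :
    nonzeroCount (m + 2) a = 2 * (n - 2).choose (m + 1) := by
  have hs : ∀ p, ∀ y ∈ powersetCard p ({i, j}ᶜ : Finset (Fin n)),
      i ∉ y ∧ j ∉ y ∧ ∑ l ∈ y, a l = 0 := by
    intro p y hy
    have hy' := (mem_powersetCard.mp hy).1
    have h : ∀ l ∈ y, l ≠ i ∧ l ≠ j := fun l hl => by simpa using hy' hl
    exact ⟨fun h' => (h i h').1 rfl, fun h' => (h j h').2 rfl,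
      sum_eq_zero fun l hl => ha l (h l hl).1 (h l hl).2⟩
  rw [nonzeroCount_eq_sum, univ_eq_pair (i := i) (j := j),
    sum_powersetCard_insert_insert hij (by simp) (by simp)]
  have h1 : ∑ x ∈ powersetCard (m + 2) ({i, j}ᶜ : Finset (Fin n)), nz a x = 0 :=
    sum_eq_zero fun x hx => by simp [nz, (hs _ x hx).2.2]
  have h3 : ∑ y ∈ powersetCard m ({i, j}ᶜ : Finset (Fin n)), nz a (insert i (insert j y)) = 0 :=
    sum_eq_zero fun y hy => by
      obtain ⟨h1, h2, h3⟩ := hs _ y hy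
      rw [nz, sum_insert (by simp [h1, hij]), sum_insert h2, h3, hj]
      simp
  have h2 : ∀ y ∈ powersetCard (m + 1) ({i, j}ᶜ : Finset (Fin n)),
      nz a (insert i y) + nz a (insert j y) = 2 := fun y hy => by
    obtain ⟨h1, h2, h3⟩ := hs _ y hy
    rw [nz, nz, sum_insert h1, sum_insert h2, h3, hj]
    simp [hi]
  rw [h1, h3, sum_congr rfl h2]
  rw [sum_const, card_powersetCard, card_compl, Fintype.card_fin, card_pair hij, smul_eq_mul,
    mul_comm, zero_add, add_zero]

/-! ### Vectors with at least three values -/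

lemma two_le_nz_add {n : ℕ} {a : Fin n → ℝ} {x y z : Finset (Fin n)}
    (hxy : ∑ l ∈ x, a l ≠ ∑ l ∈ y, a l) (hxz : ∑ l ∈ x, a l ≠ ∑ l ∈ z, a l)
    (hyz : ∑ l ∈ y, a l ≠ ∑ l ∈ z, a l) : 2 ≤ nz a x + nz a y + nz a z := by
  unfold nz
  split_ifs <;> simp_all

/-- A vector with three different values has many nonzero `w`-sums; if the bound is sharp, all
`w`-sums avoiding the three coordinates vanish and two of any three `w`-sums differing only in
these coordinates are nonzero. -/
lemma nonzeroCount_three_values {n m : ℕ} {a : Fin n → ℝ} {i j k : Fin n}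
    (hij : a i ≠ a j) (hik : a i ≠ a k) (hjk : a j ≠ a k) :
    2 * (n - 2).choose (m + 1)
      + ∑ x ∈ powersetCard (m + 2) ({i, j, k}ᶜ : Finset (Fin n)), nz a x
      + ∑ y ∈ powersetCard (m + 1) ({i, j, k}ᶜ : Finset (Fin n)),
        (nz a (insert i y) + nz a (insert j y) + nz a (insert k y) - 2)
      ≤ nonzeroCount (m + 2) a := by
  have nij : i ≠ j := fun e => hij (by rw [e])
  have nik : i ≠ k := fun e => hik (by rw [e])
  have njk : j ≠ k := fun e => hjk (by rw [e])
  set s : Finset (Fin n) := {i, j, k}ᶜ with hs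
  have his : i ∉ s := by simp [hs]
  have hjs : j ∉ s := by simp [hs]
  have hks : k ∉ s := by simp [hs]
  have hcard : s.card = n - 3 := by
    rw [hs, card_compl, Fintype.card_fin, card_insert_of_notMem (by simp [nij, nik]),
      card_pair njk]
  have hn : 3 ≤ n := by
    have := card_le_univ ({i, j, k} : Finset (Fin n))
    rwa [Fintype.card_fin, card_insert_of_notMem (by simp [nij, nik]), card_pair njk] at this
  have hnot : ∀ p, ∀ y ∈ powersetCard p s, i ∉ y ∧ j ∉ y ∧ k ∉ y := fun p y hy =>
    have h := (mem_powersetCard.mp hy).1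
    ⟨fun h' => his (h h'), fun h' => hjs (h h'), fun h' => hks (h h')⟩
  have huniv : (univ : Finset (Fin n)) = insert i (insert j (insert k s)) := by
    ext l; simp [hs]; tauto
  rw [nonzeroCount_eq_sum, huniv,
    sum_powersetCard_insert_insert nij (by simp [nik, his]) (by simp [njk, hjs]),
    sum_powersetCard_insert hks, sum_powersetCard_insert hks]
  have h1 : ∑ y ∈ powersetCard (m + 1) s, (nz a (insert i y) + nz a (insert j y))
      + ∑ y ∈ powersetCard (m + 1) s, nz a (insert k y)
      = 2 * (n - 3).choose (m + 1) + ∑ y ∈ powersetCard (m + 1) s,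
        (nz a (insert i y) + nz a (insert j y) + nz a (insert k y) - 2) := by
    have hc : 2 * (n - 3).choose (m + 1) = ∑ y ∈ powersetCard (m + 1) s, 2 := by
      rw [sum_const, card_powersetCard, hcard, smul_eq_mul, mul_comm]
    rw [hc, ← sum_add_distrib, ← sum_add_distrib]
    refine sum_congr rfl fun y hy => ?_
    obtain ⟨hi, hj, hk⟩ := hnot _ y hy
    -- This bound makes the truncated subtraction of 2 exact.
    have := two_le_nz_add (a := a) (x := insert i y) (y := insert j y) (z := insert k y)
      (by simpa [sum_insert, hi, hj] using hij) (by simpa [sum_insert, hi, hk] using hik)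
      (by simpa [sum_insert, hj, hk] using hjk)
    omega
  have h2 : 2 * (n - 3).choose m ≤
      ∑ y ∈ powersetCard m s, (nz a (insert i (insert k y)) + nz a (insert j (insert k y)))
      + ∑ y ∈ powersetCard m (insert k s), nz a (insert i (insert j y)) := by
    -- The `w`-sets containing all of `i, j, k` are discarded here.
    have hsub : ∑ y ∈ powersetCard m s, nz a (insert i (insert j y)) ≤
        ∑ y ∈ powersetCard m (insert k s), nz a (insert i (insert j y)) :=
      sum_le_sum_of_subset (powersetCard_mono (subset_insert _ _))
    refine le_trans ?_ (Nat.add_le_add_left hsub _)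
    have hc : 2 * (n - 3).choose m = ∑ y ∈ powersetCard m s, 2 := by
      rw [sum_const, card_powersetCard, hcard, smul_eq_mul, mul_comm]
    rw [hc, ← sum_add_distrib]
    refine sum_le_sum fun y hy => ?_
    obtain ⟨hi, hj, hk⟩ := hnot _ y hy
    refine two_le_nz_add ?_ ?_ ?_ <;>
    · rw [sum_insert (by simp [*]), sum_insert (by simp [*]), sum_insert (by simp [*]),
        sum_insert (by simp [*])]
      intro h
      first
        | exact hij (by linarith)
        | exact hjk (by linarith)
        | exact hik (by linarith)
  have h3 : (n - 2).choose (m + 1) = (n - 3).choose m + (n - 3).choose (m + 1) := by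
    rw [show n - 2 = n - 3 + 1 by omega, Nat.choose_succ_succ]
  rw [show m + 1 + 1 = m + 2 from rfl]
  omega

/-- The equality case of the bound for vectors with three different values. -/
lemma support_pair_of_three_values {n m : ℕ} (hn : m + 6 ≤ n) {a : Fin n → ℝ} {i j k : Fin n}
    (hij : a i ≠ a j) (hik : a i ≠ a k) (hjk : a j ≠ a k)
    (hsum : ∑ l, a l = 0)
    (hle : nonzeroCount (m + 2) a ≤ 2 * (n - 2).choose (m + 1)) :
    ∃ p q : Fin n, p ≠ q ∧ a p ≠ 0 ∧ a q = -a p ∧ ∀ l, l ≠ p → l ≠ q → a l = 0 := by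
  have nij : i ≠ j := fun e => hij (by rw [e])
  have nik : i ≠ k := fun e => hik (by rw [e])
  have njk : j ≠ k := fun e => hjk (by rw [e])
  have key := nonzeroCount_three_values (m := m) hij hik hjk
  set s : Finset (Fin n) := {i, j, k}ᶜ with hs
  have hcard : s.card = n - 3 := by
    rw [hs, card_compl, Fintype.card_fin, card_insert_of_notMem (by simp [nij, nik]),
      card_pair njk]
  have z1 := sum_eq_zero_iff.mp (show ∑ x ∈ powersetCard (m + 2) s, nz a x = 0 by omega)
  have z2 := sum_eq_zero_iff.mp (show ∑ y ∈ powersetCard (m + 1) s,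
    (nz a (insert i y) + nz a (insert j y) + nz a (insert k y) - 2) = 0 by omega)
  have z1' : ∀ x ∈ powersetCard (m + 2) s, ∑ l ∈ x, a l = 0 := fun x hx => by
    simpa [nz] using z1 x hx
  have hconst : ∀ p ∈ s, ∀ q ∈ s, a p = a q := by
    intro p hp q hq
    -- Exchanging `p` for `q` inside `s` needs `|s| = n - 3 ≥ w + 1`, whence the hypothesis `n ≥ w +
    -- 4`.
    obtain ⟨y, hy, hy'⟩ := exists_mem_powersetCard_notMem (s := s) (t := {p, q}) (m := m + 1)
      (by have := card_le_two (a := p) (b := q); omega)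
    obtain ⟨hys, hyc⟩ := mem_powersetCard.mp hy
    have h : ∀ r ∈ ({p, q} : Finset (Fin n)), r ∈ s → a r + ∑ l ∈ y, a l = 0 := by
      intro r hr hrs
      rw [← sum_insert (hy' r hr)]
      exact z1' _ (mem_powersetCard.mpr ⟨insert_subset hrs hys, by
        rw [card_insert_of_notMem (hy' r hr), hyc]⟩)
    have := h p (by simp) hp
    have := h q (by simp) hq
    linarith
  have hzero : ∀ p ∈ s, a p = 0 := by
    intro p hp
    obtain ⟨x, hx, -⟩ := exists_mem_powersetCard_notMem (s := s) (t := ∅) (m := m + 2)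
      (by rw [card_empty]; omega)
    obtain ⟨hxs, hxc⟩ := mem_powersetCard.mp hx
    have h := z1' x hx
    rw [sum_congr rfl fun l hl => hconst l (hxs hl) p hp, sum_const, hxc, nsmul_eq_mul] at h
    exact (mul_eq_zero.mp h).resolve_left (by positivity)
  have hrest : ∀ l, l ≠ i → l ≠ j → l ≠ k → a l = 0 := fun l h1 h2 h3 =>
    hzero l (by simp [hs, h1, h2, h3])
  have htot : a i + (a j + a k) = 0 := by
    have h := sum_add_sum_compl s a
    rw [sum_eq_zero hzero, hsum, hs, compl_compl, sum_insert (by simp [nij, nik]),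
      sum_pair njk] at h
    linarith
  -- For `y ⊆ s` the three `w`-sums are `a i`, `a j`, `a k` themselves, and sharpness allows at most
  -- two of them to be nonzero.
  have hone : a i = 0 ∨ a j = 0 ∨ a k = 0 := by
    obtain ⟨y, hy, -⟩ := exists_mem_powersetCard_notMem (s := s) (t := ∅) (m := m + 1)
      (by rw [card_empty]; omega)
    have hys := (mem_powersetCard.mp hy).1
    have h0 : ∑ l ∈ y, a l = 0 := sum_eq_zero fun l hl => hzero l (hys hl)
    have h := z2 y hy
    by_contra! hne
    rw [nz, nz, nz, sum_insert (fun h => by simpa [hs] using hys h),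
      sum_insert (fun h => by simpa [hs] using hys h),
      sum_insert (fun h => by simpa [hs] using hys h), h0] at h
    simp [hne] at h
  rcases hone with h0 | h0 | h0
  · refine ⟨j, k, njk, fun h => hij (by rw [h0, h]), by linarith, fun l h1 h2 => ?_⟩
    by_cases h : l = i
    · rw [h, h0]
    · exact hrest l h h1 h2
  · refine ⟨i, k, nik, fun h => hij (by rw [h0, h]), by linarith, fun l h1 h2 => ?_⟩
    by_cases h : l = j
    · rw [h, h0]
    · exact hrest l h1 h h2
  · refine ⟨i, j, nij, fun h => hik (by rw [h0, h]), by linarith, fun l h1 h2 => ?_⟩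
    by_cases h : l = k
    · rw [h, h0]
    · exact hrest l h1 h2 h

/-! ### Vectors with exactly two values -/

lemma card_filter_inter {α : Type*} [Fintype α] [DecidableEq α] (s : Finset α) {w p : ℕ}
    (hp : p ≤ w) :
    ((powersetCard w univ).filter fun x => (x ∩ s).card = p).card =
      s.card.choose p * (Fintype.card α - s.card).choose (w - p) := by
  rw [← card_compl, ← card_powersetCard, ← card_powersetCard, ← card_product]
  have hdisj : ∀ q ∈ powersetCard p s ×ˢ powersetCard (w - p) sᶜ, Disjoint q.1 q.2 :=
    fun q hq => by
      obtain ⟨h1, h2⟩ := mem_product.mp hq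
      exact disjoint_compl_right.mono (mem_powersetCard.mp h1).1 (mem_powersetCard.mp h2).1
  refine card_nbij' (fun x => (x ∩ s, x \ s)) (fun q => q.1 ∪ q.2) ?_ ?_ ?_ ?_
  · intro x hx
    simp only [coe_filter, Set.mem_ofPred_eq, mem_powersetCard] at hx
    have := card_sdiff_add_card_inter x s
    simp only [coe_product, Set.mem_prod, mem_coe, mem_powersetCard]
    refine ⟨⟨inter_subset_right, hx.2⟩, fun l hl => ?_, by omega⟩
    simpa using (mem_sdiff.mp hl).2
  · intro q hq
    have hd := hdisj q hq
    simp only [coe_product, Set.mem_prod, mem_coe, mem_powersetCard] at hq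
    have h2 : q.2 ∩ s = ∅ :=
      disjoint_iff_inter_eq_empty.mp (disjoint_compl_left.mono_left hq.2.1)
    simp only [coe_filter, Set.mem_ofPred_eq, mem_powersetCard]
    rw [card_union_of_disjoint hd, union_inter_distrib_right, h2, union_empty,
      inter_eq_left.mpr hq.1.1]
    exact ⟨⟨subset_univ _, by omega⟩, hq.1.2⟩
  · intro x _
    exact sup_inf_sdiff x s
  · intro q hq
    simp only [coe_product, Set.mem_prod, mem_coe, mem_powersetCard] at hq
    have h2 : Disjoint q.2 s := disjoint_compl_left.mono_left hq.2.1
    ext1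
    · simp only [union_inter_distrib_right, disjoint_iff_inter_eq_empty.mp h2, union_empty,
        inter_eq_left.mpr hq.1.1]
    · simp only [union_sdiff_distrib, sdiff_eq_empty_iff_subset.mpr hq.1.1, empty_union,
        sdiff_eq_self_of_disjoint h2]

lemma nonzeroCount_add_card {n : ℕ} (w : ℕ) (a : Fin n → ℝ) :
    nonzeroCount w a + ((powersetCard w univ).filter fun x => ∑ i ∈ x, a i = 0).card =
      n.choose w := by
  have h := card_filter_add_card_filter_not (s := powersetCard w (univ : Finset (Fin n)))
    (fun x => ∑ i ∈ x, a i = 0)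
  rw [card_powersetCard, card_univ, Fintype.card_fin] at h
  simp only [nonzeroCount, ne_eq]
  omega

/-- The vanishing `x`-sums of a zero-sum vector with values `c` on `s` and `d` off `s`. -/
lemma sum_eq_zero_iff_card_inter {n : ℕ} (hn : 0 < n) {a : Fin n → ℝ} {s : Finset (Fin n)}
    {c d : ℝ} (hcd : c ≠ d) (hs : ∀ i ∈ s, a i = c) (hs' : ∀ i ∉ s, a i = d)
    (hsum : ∑ i, a i = 0) (x : Finset (Fin n)) :
    ∑ i ∈ x, a i = 0 ↔ (x ∩ s).card * n = s.card * x.card := by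
  have hval : ∀ y : Finset (Fin n), ∑ i ∈ y, a i = (y ∩ s).card * (c - d) + y.card * d := by
    intro y
    have h1 : ∀ i ∈ y, a i = (if i ∈ s then c - d else 0) + d := fun i _ => by
      split_ifs with h
      · rw [hs i h]; ring
      · rw [hs' i h]; ring
    rw [sum_congr rfl h1, sum_add_distrib, ← sum_filter, sum_const, sum_const,
      filter_mem_eq_inter, nsmul_eq_mul, nsmul_eq_mul]
  have h0 := hval univ
  rw [hsum, univ_inter, card_univ, Fintype.card_fin] at h0
  have hn : (n : ℝ) ≠ 0 := by exact_mod_cast hn.ne'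
  rw [hval x]
  -- The zero total, `|s|(c - d) + n d = 0`, eliminates `d`.
  have h2 : ((x ∩ s).card * (c - d) + x.card * d) * n =
      (c - d) * ((x ∩ s).card * n - s.card * x.card) := by
    linear_combination (-(x.card : ℝ)) * h0
  have hcd' : c - d ≠ 0 := sub_ne_zero.mpr hcd
  rw [← mul_left_inj' hn, h2, zero_mul, mul_eq_zero, or_iff_right hcd', sub_eq_zero]
  exact_mod_cast Iff.rfl

lemma nonzeroCount_two_valued {n w : ℕ} (hn : 0 < n) {a : Fin n → ℝ} {s : Finset (Fin n)}
    {c d : ℝ} (hcd : c ≠ d) (hs : ∀ i ∈ s, a i = c) (hs' : ∀ i ∉ s, a i = d)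
    (hsum : ∑ i, a i = 0) (hdvd : n ∣ s.card * w) :
    nonzeroCount w a + s.card.choose (s.card * w / n) *
      (n - s.card).choose ((n - s.card) * w / n) = n.choose w := by
  obtain ⟨p, hp⟩ := hdvd
  have hk : s.card ≤ n := by simpa using card_le_univ s
  have hpw : p ≤ w := by
    refine Nat.le_of_mul_le_mul_left ?_ hn
    rw [← hp]
    exact Nat.mul_le_mul_right _ hk
  have h2 : (n - s.card) * w = n * (w - p) := by rw [Nat.sub_mul, hp, Nat.mul_sub]
  rw [← nonzeroCount_add_card w a, h2, hp, Nat.mul_div_cancel_left _ hn,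
    Nat.mul_div_cancel_left _ hn]
  congr 1
  have h := card_filter_inter s hpw
  rw [Fintype.card_fin] at h
  rw [← h]
  congr 1
  refine filter_congr fun x hx => ?_
  rw [sum_eq_zero_iff_card_inter hn hcd hs hs' hsum, (mem_powersetCard.mp hx).2, hp, mul_comm]
  exact (Nat.mul_right_inj hn.ne').symm

lemma nonzeroCount_two_valued_of_not_dvd {n w : ℕ} (hn : 0 < n) {a : Fin n → ℝ} {s : Finset (Fin n)}
    {c d : ℝ} (hcd : c ≠ d) (hs : ∀ i ∈ s, a i = c) (hs' : ∀ i ∉ s, a i = d)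
    (hsum : ∑ i, a i = 0) (hdvd : ¬ n ∣ s.card * w) :
    nonzeroCount w a = n.choose w := by
  rw [← nonzeroCount_add_card w a, left_eq_add, card_eq_zero, filter_eq_empty_iff]
  intro x hx h
  rw [sum_eq_zero_iff_card_inter hn hcd hs hs' hsum, (mem_powersetCard.mp hx).2] at h
  exact hdvd ⟨_, by rw [← h, mul_comm]⟩

/-- Either of `k = 1` and `k = n - 1` would give `n ∣ w`, so the range `2 ≤ k ≤ n - 2` loses no
case. -/
lemma two_le_of_dvd {n w k : ℕ} (hw : 1 ≤ w) (hwn : w < n) (hk : 1 ≤ k) (hkn : k < n)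
    (hdvd : n ∣ k * w) : 2 ≤ k ∧ k ≤ n - 2 := by
  constructor
  · by_contra! h
    obtain rfl : k = 1 := by omega
    rw [one_mul] at hdvd
    exact absurd (Nat.le_of_dvd hw hdvd) (by omega)
  · by_contra! h
    obtain ⟨n, rfl⟩ := Nat.exists_eq_add_of_le' (show 1 ≤ n by omega)
    obtain rfl : k = n := by omega
    have h2 : k + 1 ∣ k * w + w := ⟨w, by ring⟩
    exact absurd (Nat.le_of_dvd hw ((Nat.dvd_add_right hdvd).mp h2)) (by omega)

lemma le_maxZeros {n w k : ℕ} (hk : 2 ≤ k) (hkn : k ≤ n - 2) (hdvd : n ∣ k * w) :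
    k.choose (k * w / n) * (n - k).choose ((n - k) * w / n) ≤ maxZeros n w :=
  le_sup (f := fun k => k.choose (k * w / n) * (n - k).choose ((n - k) * w / n))
    (by simp [admissible, hk, hkn, hdvd])

/-- A nonconstant vector either has three different values or exactly two. -/
lemma three_values_or_two {ι : Type*} [Fintype ι] [DecidableEq ι] {a : ι → ℝ} {i j : ι}
    (hij : a i ≠ a j) :
    (∃ i j k, a i ≠ a j ∧ a i ≠ a k ∧ a j ≠ a k) ∨
      ∃ s : Finset ι, i ∈ s ∧ j ∉ s ∧ (∀ l ∈ s, a l = a i) ∧ ∀ l ∉ s, a l = a j := by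
  by_cases h : ∃ k, a i ≠ a k ∧ a j ≠ a k
  · obtain ⟨k, h1, h2⟩ := h
    exact Or.inl ⟨i, j, k, hij, h1, h2⟩
  · push Not at h
    refine Or.inr ⟨univ.filter fun l => a l = a i, by simp, by simpa using hij.symm,
      by simp, fun l hl => (h l fun e => ?_).symm⟩
    simp [e] at hl

lemma exists_ne_of_sum_eq_zero {ι : Type*} [Fintype ι] {a : ι → ℝ} (h0 : a ≠ 0)
    (hsum : ∑ i, a i = 0) : ∃ i j, a i ≠ a j := by
  by_contra! h
  obtain ⟨i, hi⟩ := Function.ne_iff.mp h0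
  have : Nonempty ι := ⟨i⟩
  rw [sum_congr rfl fun j _ => h j i, sum_const, card_univ, nsmul_eq_mul] at hsum
  exact (mul_ne_zero (by exact_mod_cast Fintype.card_ne_zero) hi) hsum

/-! ### Normal forms up to permutation and scaling -/

lemma inclusion_comp {n w : ℕ} (a b : Fin n → ℝ) (σ : Equiv.Perm (Fin n)) {c : ℝ} (hc : c ≠ 0)
    (h : ∀ i, a i = c * b (σ i)) : Equivalent (inclusion n w a) (inclusion n w b) :=
  ⟨σ, c, hc, fun x => by simp [inclusion, permute, h, mul_sum]⟩

lemma exists_perm_mem_iff {n : ℕ} (s : Finset (Fin n)) :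
    ∃ σ : Equiv.Perm (Fin n), ∀ i, i ∈ s ↔ (σ i).val < s.card := by
  have hk : s.card ≤ n := by simpa using card_le_univ s
  have hcard : Fintype.card {i // i ∈ s} = Fintype.card {i : Fin n // i.val < s.card} := by
    rw [Fintype.card_coe, Fintype.card_fin_lt_of_le hk]
  let e := Fintype.equivOfCardEq hcard
  refine ⟨e.extendSubtype, fun i => ⟨fun h => e.extendSubtype_mem i h, fun h => ?_⟩⟩
  by_contra hi
  exact e.extendSubtype_not_mem i hi h

lemma exists_perm_pair {n : ℕ} {i j p q : Fin n} (hij : i ≠ j) (hpq : p ≠ q) :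
    ∃ σ : Equiv.Perm (Fin n), σ i = p ∧ σ j = q := by
  refine ⟨(Equiv.swap i p).trans (Equiv.swap (Equiv.swap i p j) q), ?_, by simp⟩
  simp only [Equiv.trans_apply, Equiv.swap_apply_left]
  refine Equiv.swap_apply_of_ne_of_ne ?_ hpq
  intro h
  rw [← Equiv.swap_apply_left i p] at h
  exact hij ((Equiv.swap i p).injective (by simpa using h))

lemma equivalent_basisDiff {n w : ℕ} (hn : 2 ≤ n) {a : Fin n → ℝ} {p q : Fin n} (hpq : p ≠ q)
    (hp : a p ≠ 0) (hq : a q = -a p) (ha : ∀ l, l ≠ p → l ≠ q → a l = 0) :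
    Equivalent (inclusion n w a) (inclusion n w (basisDiff n)) := by
  obtain ⟨σ, h1, h2⟩ := exists_perm_pair hpq
    (show (⟨0, by omega⟩ : Fin n) ≠ ⟨1, by omega⟩ by simp)
  refine inclusion_comp a _ σ hp fun l => ?_
  by_cases hlp : l = p
  · simp [hlp, h1, basisDiff]
  by_cases hlq : l = q
  · simp [hlq, h2, basisDiff, hq]
  have h3 : (σ l).val ≠ 0 := fun h => hlp (σ.injective (by rw [h1]; exact Fin.ext h))
  have h4 : (σ l).val ≠ 1 := fun h => hlq (σ.injective (by rw [h2]; exact Fin.ext h))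
  simp [ha l hlp hlq, basisDiff, h3, h4]

lemma equivalent_twoValued {n w : ℕ} {a : Fin n → ℝ} {s : Finset (Fin n)} {c d : ℝ}
    (hk : s.card < n) (hcd : c ≠ d) (hs : ∀ i ∈ s, a i = c) (hs' : ∀ i ∉ s, a i = d)
    (hsum : ∑ i, a i = 0) :
    Equivalent (inclusion n w a) (inclusion n w (twoValued n s.card)) := by
  have hk' : (s.card : ℝ) < n := by exact_mod_cast hk
  have hsub : (n - s.card : ℝ) ≠ 0 := by linarith
  have h0 : s.card * c + (n - s.card) * d = 0 := by
    rw [← sum_add_sum_compl s, sum_congr rfl hs,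
      sum_congr rfl fun i hi => hs' i (mem_compl.mp hi), sum_const, sum_const, card_compl,
      Fintype.card_fin, nsmul_eq_mul, nsmul_eq_mul, Nat.cast_sub hk.le] at hsum
    exact hsum
  have hd : d = c * -(s.card / (n - s.card)) := by
    field_simp
    linarith
  have hc : c ≠ 0 := by
    rintro rfl
    rw [zero_mul] at hd
    exact hcd hd.symm
  obtain ⟨σ, hσ⟩ := exists_perm_mem_iff s
  refine inclusion_comp a _ σ hc fun l => ?_
  by_cases h : l ∈ s
  · simp [hs l h, twoValued, (hσ l).mp h]
  · rw [hs' l h, twoValued, if_neg (fun h' => h ((hσ l).mpr h')), ← hd]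

/-! ### The extremal vectors and their support sizes -/

lemma sum_basisDiff {n : ℕ} (hn : 2 ≤ n) : ∑ i, basisDiff n i = 0 := by
  obtain ⟨n, rfl⟩ := Nat.exists_eq_add_of_le' hn
  simp [Fin.sum_univ_succ, basisDiff]

lemma nonzeroCount_basisDiff {n m : ℕ} (hn : 2 ≤ n) :
    nonzeroCount (m + 2) (basisDiff n) = 2 * (n - 2).choose (m + 1) :=
  nonzeroCount_of_support_pair (i := ⟨0, by omega⟩) (j := ⟨1, by omega⟩) (by simp)
    (by simp [basisDiff]) (by simp [basisDiff]) fun l h1 h2 => by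
      have h1' : l.val ≠ 0 := fun h => h1 (Fin.ext h)
      have h2' : l.val ≠ 1 := fun h => h2 (Fin.ext h)
      simp [basisDiff, h1', h2']

/-- Pascal's rule twice gives `C(n,w) = C(n-2,w) + 2 C(n-2,w-1) + C(n-2,w-2)`. A vector of full
support is thus never minimal. -/
lemma two_mul_choose_lt {n m : ℕ} (hn : m + 4 ≤ n) :
    2 * (n - 2).choose (m + 1) < n.choose (m + 2) := by
  obtain ⟨n, rfl⟩ := Nat.exists_eq_add_of_le' (show 2 ≤ n by omega)
  have h := Nat.choose_pos (show m + 2 ≤ n by omega)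
  have h' := Nat.choose_pos (show m ≤ n by omega)
  rw [Nat.choose_succ_succ, Nat.choose_succ_succ n m, Nat.choose_succ_succ n (m + 1)]
  simp only [Nat.add_sub_cancel, Nat.succ_eq_add_one]
  have e : m + 1 + 1 = m + 2 := rfl
  rw [e]
  omega

section TwoValued

variable {n k : ℕ}

lemma card_filter_val_lt (hk : k ≤ n) : (univ.filter fun i : Fin n => i.val < k).card = k := by
  rw [← Fintype.card_subtype, Fintype.card_fin_lt_of_le hk]

lemma twoValued_ne (hk : k < n) : (1 : ℝ) ≠ -((k : ℝ) / ((n : ℝ) - k)) := by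
  have h : (k : ℝ) < n := by exact_mod_cast hk
  have : 0 ≤ (k : ℝ) / ((n : ℝ) - k) := div_nonneg (by positivity) (by linarith)
  intro h
  linarith

lemma sum_twoValued (hk : k < n) : ∑ i, twoValued n k i = 0 := by
  have h : (k : ℝ) < n := by exact_mod_cast hk
  have h' : (n : ℝ) - k ≠ 0 := by linarith
  have hc := card_filter_add_card_filter_not (s := univ) (fun i : Fin n => i.val < k)
  rw [card_filter_val_lt hk.le, card_univ,
    Fintype.card_fin] at hc
  have hc' : ((univ.filter fun i : Fin n => ¬ i.val < k).card : ℝ) = n - k := by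
    have h1 : (k : ℝ) + ((univ.filter fun i : Fin n => ¬ i.val < k).card : ℝ) = n := by
      exact_mod_cast hc
    linarith
  simp only [twoValued]
  rw [sum_ite, sum_const, sum_const, card_filter_val_lt hk.le, nsmul_eq_mul, nsmul_eq_mul, hc']
  field_simp
  ring

lemma nonzeroCount_twoValued {w : ℕ} (hk : k < n) (hdvd : n ∣ k * w) :
    nonzeroCount w (twoValued n k) + k.choose (k * w / n) *
      (n - k).choose ((n - k) * w / n) = n.choose w := by
  have h := nonzeroCount_two_valued (w := w) (by omega) (a := twoValued n k)
    (s := univ.filter fun i : Fin n => i.val < k) (twoValued_ne hk)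
    (fun i hi => if_pos (mem_filter.mp hi).2) (fun i hi => if_neg (by simpa using hi))
    (sum_twoValued hk) (by rwa [card_filter_val_lt hk.le])
  rwa [card_filter_val_lt hk.le] at h

lemma inclusion_twoValued_ne_zero {w : ℕ} (hw : 1 ≤ w) (hwn : w < n) (hk : 1 ≤ k)
    (hkn : k < n) : inclusion n w (twoValued n k) ≠ 0 :=
  inclusion_ne_zero hw hwn (i := ⟨0, by omega⟩) (j := ⟨k, hkn⟩) (by
    simpa [twoValued, show 0 < k by omega] using twoValued_ne hkn)

end TwoValued

lemma inclusion_basisDiff_ne_zero {n w : ℕ} (hw : 1 ≤ w) (hwn : w < n) :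
    inclusion n w (basisDiff n) ≠ 0 :=
  inclusion_ne_zero hw hwn (i := ⟨0, by omega⟩) (j := ⟨1, by omega⟩) (by
    norm_num [basisDiff])

/-- For `n = 2w` the two-valued vector with `k = 2` beats `e_1 - e_2`. -/
lemma nonzeroCount_twoValued_two_lt {m : ℕ} :
    nonzeroCount (m + 2) (twoValued (2 * (m + 2)) 2) <
      2 * (2 * (m + 2) - 2).choose (m + 1) := by
  have h := nonzeroCount_twoValued (n := 2 * (m + 2)) (k := 2) (w := m + 2) (by omega)
    (dvd_refl _)
  have e : (2 * (m + 2) - 2) * (m + 2) / (2 * (m + 2)) = m + 1 := by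
    rw [show (2 * (m + 2) - 2) * (m + 2) = (m + 1) * (2 * (m + 2)) by
      rw [show 2 * (m + 2) - 2 = 2 * (m + 1) by omega]; ring]
    exact Nat.mul_div_cancel _ (by omega)
  rw [e, Nat.div_self (by omega), Nat.choose_one_right] at h
  -- With `C = C(2m+2, m+1)` the claim is `C(2m+4, m+2) < 4C`; the recurrence reduces it to `2(2m+3)
  -- < 4(m+2)`.
  have hc := Nat.succ_mul_centralBinom_succ (m + 1)
  rw [Nat.centralBinom, Nat.centralBinom] at hc
  rw [show 2 * (m + 2) - 2 = 2 * (m + 1) by omega] at h ⊢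
  have hpos := Nat.choose_pos (show m + 1 ≤ 2 * (m + 1) by omega)
  set C := (2 * (m + 1)).choose (m + 1)
  rw [show m + 1 + 1 = m + 2 from rfl] at hc
  have : (m + 2) * (2 * (m + 2)).choose (m + 2) < (m + 2) * (4 * C) := by
    rw [hc]
    nlinarith
  have := Nat.lt_of_mul_lt_mul_left this
  omega

/-! ### The minimum and its attainment -/

/-- Every nonzero zero-sum vector has three different values, or two values with an admissible
multiplicity, or two values and no vanishing `w`-sum. -/
lemma zero_sum_trichotomy {n w : ℕ} (hw : 1 ≤ w) (hwn : w < n) {a : Fin n → ℝ} (h0 : a ≠ 0)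
    (hsum : ∑ i, a i = 0) :
    (∃ i j k, a i ≠ a j ∧ a i ≠ a k ∧ a j ≠ a k) ∨
    (∃ k, 2 ≤ k ∧ k ≤ n - 2 ∧ n ∣ k * w ∧
      Equivalent (inclusion n w a) (inclusion n w (twoValued n k)) ∧
      nonzeroCount w a + k.choose (k * w / n) * (n - k).choose ((n - k) * w / n) =
        n.choose w) ∨
    nonzeroCount w a = n.choose w := by
  obtain ⟨i, j, hij⟩ := exists_ne_of_sum_eq_zero h0 hsum
  refine (three_values_or_two hij).imp_right ?_
  rintro ⟨s, hi, hj, hs, hs'⟩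
  have hn : 0 < n := by omega
  have hk1 : 1 ≤ s.card := card_pos.mpr ⟨i, hi⟩
  have hkn : s.card < n := by simpa using card_lt_univ_of_notMem hj
  by_cases hdvd : n ∣ s.card * w
  · obtain ⟨h1, h2⟩ := two_le_of_dvd hw hwn hk1 hkn hdvd
    exact Or.inl ⟨s.card, h1, h2, hdvd, equivalent_twoValued hkn hij hs hs' hsum,
      nonzeroCount_two_valued hn hij hs hs' hsum hdvd⟩
  · exact Or.inr (nonzeroCount_two_valued_of_not_dvd hn hij hs hs' hsum hdvd)

/-- The lower bound for the support size of an eigenvector. -/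
lemma min_le_nonzeroCount {n m : ℕ} (hn : m + 4 ≤ n) {a : Fin n → ℝ} (h0 : a ≠ 0)
    (hsum : ∑ i, a i = 0) :
    min (2 * (n - 2).choose (m + 1)) (n.choose (m + 2) - maxZeros n (m + 2)) ≤
      nonzeroCount (m + 2) a := by
  rcases zero_sum_trichotomy (w := m + 2) (by omega) (by omega) h0 hsum with
    ⟨i, j, k, hij, hik, hjk⟩ | ⟨k, h1, h2, h3, -, h4⟩ | h
  · have := nonzeroCount_three_values (m := m) hij hik hjk
    omega
  · have := le_maxZeros h1 h2 h3
    omega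
  · have := two_mul_choose_lt hn
    omega

lemma exists_nonzeroCount_eq {n m : ℕ} (hn : m + 4 ≤ n) :
    ∃ a : Fin n → ℝ, ∑ i, a i = 0 ∧ inclusion n (m + 2) a ≠ 0 ∧ nonzeroCount (m + 2) a =
      min (2 * (n - 2).choose (m + 1)) (n.choose (m + 2) - maxZeros n (m + 2)) := by
  have hlt := two_mul_choose_lt hn
  rcases le_total (2 * (n - 2).choose (m + 1)) (n.choose (m + 2) - maxZeros n (m + 2)) with h | h
  · rw [min_eq_left h]
    exact ⟨basisDiff n, sum_basisDiff (by omega), inclusion_basisDiff_ne_zero (by omega) (by omega),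
      nonzeroCount_basisDiff (by omega)⟩
  · rw [min_eq_right h]
    -- With no admissible `k` the second term would be `C(n,w)`, which exceeds the first.
    have hne : (admissible n (m + 2)).Nonempty := by
      by_contra he
      rw [not_nonempty_iff_eq_empty] at he
      rw [maxZeros, he, sup_empty, bot_eq_zero] at h
      omega
    obtain ⟨k, hk, hmax⟩ := exists_mem_eq_sup (admissible n (m + 2)) hne
      fun k => k.choose (k * (m + 2) / n) * (n - k).choose ((n - k) * (m + 2) / n)
    rw [admissible, mem_filter, mem_Icc] at hk
    have hkn : k < n := by omega
    refine ⟨twoValued n k, sum_twoValued hkn,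
      inclusion_twoValued_ne_zero (by omega) (by omega) (by omega) hkn, ?_⟩
    rw [maxZeros, hmax, ← nonzeroCount_twoValued hkn hk.2, Nat.add_sub_cancel]

end Johnson

theorem theorem1 (n w : ℕ) (hn : 2 * w ≤ n) (hw : 2 ≤ w) :
    (¬ (n = 5 ∧ w = 2) →
      ∀ v : Johnson.Vertex n w → ℝ, Johnson.IsMinSupportEigenvector 1 v →
        Johnson.Equivalent v (Johnson.inclusion n w (Johnson.basisDiff n)) ∨
        ∃ k : ℕ, 2 ≤ k ∧ k ≤ n - 2 ∧ n ∣ k * w ∧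
          Johnson.Equivalent v (Johnson.inclusion n w (Johnson.twoValued n k))) ∧
    IsLeast (Johnson.supportSizes n w 1)
      (min (2 * (n - 2).choose (w - 1)) (n.choose w - Johnson.maxZeros n w)) := by
  open Johnson in
  obtain ⟨m, rfl⟩ := Nat.exists_eq_add_of_le' hw
  have hmem := mem_eigenspace_one_iff (n := n) (w := m + 2) (by omega) (by omega)
  rw [show m + 2 - 1 = m + 1 from rfl]
  have hne : ∀ a : Fin n → ℝ, inclusion n (m + 2) a ≠ 0 → a ≠ 0 := by
    rintro a h rfl
    exact h (funext fun x => by simp [inclusion])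
  refine ⟨fun hnw v ⟨hv, hv0, hmin⟩ => ?_, ?_, ?_⟩
  · obtain ⟨a, hsum, rfl⟩ := (hmem v).mp hv
    have hmin' : ∀ b : Fin n → ℝ, ∑ i, b i = 0 → inclusion n (m + 2) b ≠ 0 →
        nonzeroCount (m + 2) a ≤ nonzeroCount (m + 2) b := fun b hb hb0 => by
      rw [← supportSize_inclusion, ← supportSize_inclusion]
      exact hmin _ ((hmem _).mpr ⟨b, hb, rfl⟩) hb0
    have hle := hmin' _ (sum_basisDiff (by omega))
      (inclusion_basisDiff_ne_zero (by omega) (by omega))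
    rw [nonzeroCount_basisDiff (by omega)] at hle
    rcases zero_sum_trichotomy (w := m + 2) (by omega) (by omega) (hne a hv0) hsum with
      ⟨i, j, k, hij, hik, hjk⟩ | ⟨k, h1, h2, h3, h4, -⟩ | h
    · have hn2 : n ≠ 2 * (m + 2) := by
        rintro rfl
        have h1 := hmin' _ (sum_twoValued (k := 2) (by omega))
          (inclusion_twoValued_ne_zero (by omega) (by omega) (by omega) (by omega))
        have h2 := nonzeroCount_twoValued_two_lt (m := m)
        have h3 := nonzeroCount_three_values (m := m) hij hik hjk
        omega
      obtain ⟨p, q, hpq, hp, hq, ha⟩ :=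
        support_pair_of_three_values (by omega) hij hik hjk hsum hle
      exact Or.inl (equivalent_basisDiff (by omega) hpq hp hq ha)
    · exact Or.inr ⟨k, h1, h2, h3, h4⟩
    · have := two_mul_choose_lt (n := n) (m := m) (by omega)
      omega
  · obtain ⟨a, hsum, ha0, hcount⟩ := exists_nonzeroCount_eq (n := n) (m := m) (by omega)
    exact ⟨_, (hmem _).mpr ⟨a, hsum, rfl⟩, ha0, by rw [supportSize_inclusion, hcount]⟩
  · rintro _ ⟨v, hv, hv0, rfl⟩
    obtain ⟨a, hsum, rfl⟩ := (hmem v).mp hv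
    rw [supportSize_inclusion]
    exact min_le_nonzeroCount (by omega) (hne a hv0) hsum
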